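/- **Theorem 2.5.** Let $M\ge 0$ and $N\ge 1$ be integers, and let $X_1,\dots,X_M,Y_1,\dots,Y_N$ be independent real random variables with $X_i\sim N(0,\sigma_{X_i}^2)$ and $Y_j\sim N(0,\sigma_{Y_j}^2)$, where all $\sigma_{X_i},\sigma_{Y_j}>0$. Put $\sigma_M=\prod_{i=1}^M\sigma_{X_i}$, $s_N=\prod_{j=1}^N\sigma_{Y_j}$ (an empty product is $1$) and $$Z=\frac{X_1\cdots X_M}{Y_1\cdots Y_N}.$$ Then $Z$ has a probability density function $f_Z$ that is continuous on $\mathbb{R}\setminus\{0\}$ (and is thereby uniquely determined there), and, as $|z|\to\infty$, $$f_Z(z)\sim\frac{2^{(M+N-2)/2}\,\sigma_M}{\pi^{(M+N)/2}\,(N-1)!\,s_N}\,\frac{(\ln|z|)^{N-1}}{z^2}.$$ Moreover, as $z\to\infty$, $$\mathbb{P}(Z>z)\sim\frac{2^{(M+N-2)/2}\,\sigma_M}{\pi^{(M+N)/2}\,(N-1)!\,s_N}\,\frac{(\ln z)^{N-1}}{z}.$$ Here $g\sim h$ means that $g/h\to1$ in the indicated limit. -/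

import Mathlib

open MeasureTheory ProbabilityTheory Filter Asymptotics

/-- The ratio `Z = (X₁ ⋯ X_M) / (Y₁ ⋯ Y_N)`; empty products are equal to one. -/
noncomputable def productRatio {Ω : Type*} {M N : ℕ} (X : Fin M → Ω → ℝ) (Y : Fin N → Ω → ℝ) :
    Ω → ℝ :=
  fun ω => (∏ i, X i ω) / (∏ j, Y j ω)

/-- `f` is the probability density function of the real random variable `Z`, in its version that is
continuous on `ℝ \ {0}` (two such versions agree at every point of `ℝ \ {0}`). -/
structure IsContinuousDensityOffZero {Ω : Type*} [MeasurableSpace Ω] (P : Measure Ω) (Z : Ω → ℝ)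
    (f : ℝ → ℝ) : Prop where
  nonneg : ∀ z, 0 ≤ f z
  continuousOn : ContinuousOn f {0}ᶜ
  hasLaw : HasLaw Z (volume.withDensity fun z => ENNReal.ofReal (f z)) P

/-- The constant `2^{(M+N-2)/2} σ_M / (π^{(M+N)/2} (N-1)! s_N)`, where `σ_M` and `s_N` are the
products of the standard deviations in the numerator and in the denominator. -/
noncomputable def tailConstant {M N : ℕ} (σ : Fin M → ℝ) (s : Fin N → ℝ) : ℝ :=
  ((2 : ℝ) ^ (((M : ℝ) + (N : ℝ) - 2) / 2) * ∏ i, σ i) /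
    (Real.pi ^ (((M : ℝ) + (N : ℝ)) / 2) * ((N - 1).factorial : ℝ) * ∏ j, s j)

open Set Topology Real

/-! The quantity that propagates is the truncated moment L(x) = E[|V|; |V| ≤ x], not the density.
Let V be a ratio with n denominators and Y an independent centred Gaussian with variance v and
density φ. Conditioning on V gives V/Y the density f(z) = z⁻² E[|V| φ(V/z)]. Since φ(a) is the
integral of (u/v) φ(u) over u > a, Fubini gives z² f(z) = ∫₀^∞ (u/v) φ(u) L(zu) du for z > 0
(`integral_abs_mul_gaussianPDFReal_div`). If L(x) ~ A (log x)^n, slow variation of the logarithm and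
dominated convergence (`LogGrowth.integral_dilation`) yield z² f(z) ~ φ(0) A (log z)^n.

As f is even, the truncated moment of V/Y is 2 ∫₀^x y f(y) dy ~ 2 φ(0) A (log x)^(n+1) / (n+1)
(`logGrowth_truncatedAbsMoment_withDensity`). So each denominator contributes one logarithm, a
factor 2 φ(0) = √(2/π)/s, and one factor of the factorial. The induction
`productRatio_truncated_moment` starts from the finite moment E|X₁⋯X_M| = ∏ √(2/π) σᵢ.

The last denominator is used only through its density, which gives the power N - 1 and the stated
constant. The tail follows from another dilation average, with weight u⁻² on u > 1
(`tendsto_integral_Ioi_of_logGrowth`). -/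

/-! ### Functions of logarithmic growth. -/

/-- `F` is measurable, is asymptotic to `B * log x ^ k` at infinity, and obeys a matching global
bound on the positive half-line. -/
structure LogGrowth (k : ℕ) (B : ℝ) (F : ℝ → ℝ) : Prop where
  measurable : Measurable F
  tendsto : Tendsto (fun x => F x / log x ^ k) atTop (𝓝 B)
  bound : ∃ C, ∀ x, 0 < x → |F x| ≤ C * (1 + log⁺ x) ^ k

/-- Submultiplicativity separates the variables in a bound at `z * u`, so that one integrable
function of `u` dominates for all large `z`. -/
lemma one_add_posLog_mul_le (x y : ℝ) :
    1 + log⁺ (x * y) ≤ (1 + log⁺ x) * (1 + log⁺ y) := by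
  have h := posLog_mul (x := x) (y := y)
  nlinarith [mul_nonneg (posLog_nonneg (x := x)) (posLog_nonneg (x := y))]

lemma tendsto_log_mul_div_log {u : ℝ} (hu : 0 < u) :
    Tendsto (fun z => log (z * u) / log z) atTop (𝓝 1) := by
  have h : Tendsto (fun z => 1 + log u / log z) atTop (𝓝 (1 + 0)) :=
    tendsto_const_nhds.add (tendsto_const_nhds.div_atTop tendsto_log_atTop)
  rw [add_zero] at h
  refine h.congr' ?_
  filter_upwards [eventually_gt_atTop 1] with z hz
  have := log_pos hz
  rw [log_mul (by positivity) hu.ne']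
  field_simp

namespace LogGrowth

variable {k : ℕ} {B : ℝ} {F : ℝ → ℝ}

lemma tendsto_comp_mul (h : LogGrowth k B F) {u : ℝ} (hu : 0 < u) :
    Tendsto (fun z => F (z * u) / log z ^ k) atTop (𝓝 B) := by
  have h1 := h.tendsto.comp (tendsto_id.atTop_mul_const hu)
  have h2 := h1.mul ((tendsto_log_mul_div_log hu).pow k)
  rw [one_pow, mul_one] at h2
  refine h2.congr' ?_
  filter_upwards [(tendsto_id.atTop_mul_const hu).eventually_gt_atTop 1] with z hz
  have : log (z * u) ≠ 0 := (log_pos hz).ne'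
  simp only [Function.comp_apply, id]
  rw [div_pow]
  field_simp

lemma exists_bound_nonneg (h : LogGrowth k B F) :
    ∃ C, 0 ≤ C ∧ ∀ x, 0 < x → |F x| ≤ C * (1 + log⁺ x) ^ k := by
  obtain ⟨C, hC⟩ := h.bound
  refine ⟨|C|, abs_nonneg _, fun x hx => (hC x hx).trans ?_⟩
  have := posLog_nonneg (x := x)
  gcongr
  exact le_abs_self C

/-- Averaging over dilations preserves logarithmic growth. -/
lemma integral_dilation (h : LogGrowth k B F) {w : ℝ → ℝ} (hw : Measurable w)
    (hint : IntegrableOn (fun u => w u * (1 + log⁺ u) ^ k) (Ioi 0)) :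
    LogGrowth k ((∫ u in Ioi 0, w u) * B) (fun z => ∫ u in Ioi 0, w u * F (z * u)) := by
  obtain ⟨C, hC0, hC⟩ := h.exists_bound_nonneg
  have hpt : ∀ z, 0 < z → ∀ u, 0 < u →
      |w u * F (z * u)| ≤ C * (1 + log⁺ z) ^ k * |w u * (1 + log⁺ u) ^ k| := by
    intro z hz u hu
    have hlu := posLog_nonneg (x := u)
    have hlz := posLog_nonneg (x := z)
    have hlzu := posLog_nonneg (x := z * u)
    rw [abs_mul, abs_mul, abs_of_nonneg (a := (1 + log⁺ u) ^ k) (by positivity)]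
    calc |w u| * |F (z * u)| ≤ |w u| * (C * ((1 + log⁺ z) * (1 + log⁺ u)) ^ k) := by
          gcongr
          refine (hC _ (mul_pos hz hu)).trans ?_
          gcongr
          exact one_add_posLog_mul_le z u
      _ = _ := by rw [mul_pow]; ring
  refine ⟨?_, ?_, ?_⟩
  · have : Measurable (Function.uncurry fun z u => w u * F (z * u)) :=
      (hw.comp measurable_snd).mul (h.measurable.comp (measurable_fst.mul measurable_snd))
    exact (this.stronglyMeasurable.integral_prod_right (ν := volume.restrict (Ioi 0))).measurable
  · simp_rw [← integral_mul_const, ← integral_div]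
    refine tendsto_integral_filter_of_dominated_convergence
      (fun u => C * 2 ^ k * |w u * (1 + log⁺ u) ^ k|) ?_ ?_ ?_ ?_
    · refine Eventually.of_forall fun z => ?_
      exact ((hw.mul (h.measurable.comp (measurable_const.mul measurable_id))).div_const
        _).aestronglyMeasurable
    -- From z ≥ e on, log z ≥ 1, so 1 + log z ≤ 2 log z; this is the source of `2 ^ k`.
    · filter_upwards [eventually_ge_atTop (exp 1)] with z hz
      have hz0 : 0 < z := (exp_pos 1).trans_le hz
      have hlog : 1 ≤ log z := by rwa [le_log_iff_exp_le hz0]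
      filter_upwards [ae_restrict_mem measurableSet_Ioi] with u hu
      rw [norm_eq_abs, abs_div, abs_of_nonneg (a := log z ^ k) (by positivity),
        div_le_iff₀ (by positivity)]
      refine (hpt z hz0 u hu).trans ?_
      have hpl : log⁺ z = log z := posLog_eq_log (by
        rw [abs_of_pos hz0]; linarith [add_one_le_exp (1 : ℝ)])
      calc C * (1 + log⁺ z) ^ k * |w u * (1 + log⁺ u) ^ k|
          ≤ C * (2 * log z) ^ k * |w u * (1 + log⁺ u) ^ k| := by
            rw [hpl]; gcongr; linarith
        _ = _ := by rw [mul_pow]; ring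
    · exact hint.abs.const_mul _
    · filter_upwards [ae_restrict_mem measurableSet_Ioi] with u hu
      simp_rw [mul_div_assoc]
      exact (h.tendsto_comp_mul hu).const_mul _
  · refine ⟨C * ∫ u in Ioi 0, |w u * (1 + log⁺ u) ^ k|, fun z hz => ?_⟩
    rw [mul_right_comm, ← integral_const_mul]
    rw [← norm_eq_abs]
    refine norm_integral_le_of_norm_le (hint.abs.const_mul _) ?_
    filter_upwards [ae_restrict_mem measurableSet_Ioi] with u hu using hpt z hz u hu

/-- The substitution x = z^t moves the integral to a fixed interval, where dominated convergence
applies and (log x)^k becomes t^k (log z)^k. -/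
lemma integral_div_eq {z : ℝ} (hz : 1 < z) (F : ℝ → ℝ) :
    ∫ x in Ioc 1 z, F x / x = log z * ∫ t in Ioc 0 1, F (exp (t * log z)) := by
  have hl := log_pos hz
  have him : (fun t => exp (t * log z)) '' Ioc 0 1 = Ioc 1 z := by
    ext x
    simp only [mem_image, mem_Ioc]
    constructor
    · rintro ⟨t, ⟨h0, h1⟩, rfl⟩
      refine ⟨by rw [one_lt_exp_iff]; positivity, ?_⟩
      rw [← le_log_iff_exp_le (by linarith)]
      nlinarith
    · rintro ⟨h1, h2⟩
      have hx := log_pos h1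
      refine ⟨log x / log z, ⟨by positivity, ?_⟩, ?_⟩
      · rw [div_le_one hl]; exact log_le_log (by linarith) h2
      · rw [div_mul_cancel₀ _ hl.ne', exp_log (by linarith)]
  have hder : ∀ t ∈ Ioc (0 : ℝ) 1,
      HasDerivWithinAt (fun t => exp (t * log z)) (exp (t * log z) * log z) (Ioc 0 1) t := by
    intro t _
    simpa using (((hasDerivAt_id t).mul_const (log z)).exp).hasDerivWithinAt
  have hinj : InjOn (fun t => exp (t * log z)) (Ioc 0 1) := by
    intro a _ b _ hab
    exact mul_right_cancel₀ hl.ne' (exp_injective hab)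
  rw [← him, integral_image_eq_integral_abs_deriv_smul measurableSet_Ioc hder hinj,
    ← integral_const_mul]
  refine integral_congr_ae (Eventually.of_forall fun t => ?_)
  have := exp_pos (t * log z)
  simp only [smul_eq_mul]
  rw [abs_of_pos (by positivity)]
  field_simp

/-- Integrating against `dx / x` raises the logarithmic order by one. -/
lemma tendsto_integral_div (h : LogGrowth k B F) :
    Tendsto (fun z => (∫ x in Ioc 1 z, F x / x) / log z ^ (k + 1)) atTop (𝓝 (B / (k + 1))) := by
  obtain ⟨C, hC0, hC⟩ := h.exists_bound_nonneg
  have hlim : Tendsto (fun z => ∫ t in Ioc 0 1, F (exp (t * log z)) / log z ^ k) atTop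
      (𝓝 (∫ t in Ioc (0 : ℝ) 1, B * t ^ k)) := by
    refine tendsto_integral_filter_of_dominated_convergence (fun _ => C * 2 ^ k) ?_ ?_ ?_ ?_
    · refine Eventually.of_forall fun z => ?_
      exact ((h.measurable.comp (by fun_prop)).div_const _).aestronglyMeasurable
    · filter_upwards [eventually_ge_atTop (exp 1)] with z hz
      have hz0 : 0 < z := (exp_pos 1).trans_le hz
      have hlog : 1 ≤ log z := by rwa [le_log_iff_exp_le hz0]
      filter_upwards [ae_restrict_mem measurableSet_Ioc] with t ht
      rw [norm_eq_abs, abs_div, abs_of_nonneg (a := log z ^ k) (by positivity),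
        div_le_iff₀ (by positivity)]
      refine (hC _ (exp_pos _)).trans ?_
      have hpl : log⁺ (exp (t * log z)) = t * log z := by
        rw [posLog_eq_log, log_exp]
        rw [abs_of_pos (exp_pos _), one_le_exp_iff]
        exact mul_nonneg ht.1.le (by linarith)
      have h0 : 0 ≤ t * log z := mul_nonneg ht.1.le (by linarith)
      rw [hpl, mul_assoc, ← mul_pow]
      gcongr
      nlinarith [ht.2]
    · exact integrable_const _
    · filter_upwards [ae_restrict_mem measurableSet_Ioc] with t ht
      have hexp : Tendsto (fun z => exp (t * log z)) atTop atTop :=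
        tendsto_exp_atTop.comp (tendsto_log_atTop.const_mul_atTop ht.1)
      have h1 := (h.tendsto.comp hexp).mul_const (t ^ k)
      refine h1.congr' ?_
      filter_upwards [eventually_gt_atTop 1] with z hz
      have := log_pos hz
      have := ht.1
      simp only [Function.comp_apply, log_exp, mul_pow]
      field_simp
  have hval : ∫ t in Ioc (0 : ℝ) 1, B * t ^ k = B / (k + 1) := by
    rw [← intervalIntegral.integral_of_le zero_le_one, intervalIntegral.integral_const_mul,
      integral_pow]
    simp
    ring
  rw [hval] at hlim
  refine hlim.congr' ?_
  filter_upwards [eventually_gt_atTop 1] with z hz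
  have := log_pos hz
  rw [integral_div_eq hz, integral_div, pow_succ']
  exact (mul_div_mul_left _ _ this.ne').symm

/-- A monotone function with a logarithmic asymptotic satisfies the global bound. -/
lemma of_monotone (hm : Monotone F) (h0 : ∀ x, 0 ≤ F x)
    (hF : Tendsto (fun x => F x / log x ^ k) atTop (𝓝 B)) : LogGrowth k B F := by
  refine ⟨hm.measurable, hF, ?_⟩
  obtain ⟨x₀, hx₀⟩ := eventually_atTop.1
    ((hF.eventually_lt_const (lt_add_one B)).and (eventually_gt_atTop 1))
  -- Beyond `x₀` the limit controls the ratio by B + 1; below it, monotonicity gives `F x₀`.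
  refine ⟨max |B + 1| (F x₀), fun x hx => ?_⟩
  have hl := posLog_nonneg (x := x)
  rw [abs_of_nonneg (h0 x)]
  rcases le_total x₀ x with hx' | hx'
  · obtain ⟨h1, h2⟩ := hx₀ x hx'
    have hlog := log_pos h2
    rw [div_lt_iff₀ (by positivity)] at h1
    rw [posLog_eq_log (by rw [abs_of_pos hx]; exact h2.le)]
    calc F x ≤ |B + 1| * log x ^ k := h1.le.trans (by gcongr; exact le_abs_self _)
      _ ≤ _ := by gcongr; exacts [le_max_left _ _, by linarith]
  · calc F x ≤ F x₀ := hm hx'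
      _ ≤ max |B + 1| (F x₀) * 1 := by rw [mul_one]; exact le_max_right _ _
      _ ≤ _ := by gcongr; exact one_le_pow₀ (by linarith)

end LogGrowth

/-- Powers of the logarithm are dominated by the square root. -/
lemma exists_one_add_posLog_pow_le (k : ℕ) :
    ∃ C, 0 ≤ C ∧ ∀ u : ℝ, 1 ≤ u → (1 + log⁺ u) ^ k ≤ C * u ^ (1 / 2 : ℝ) := by
  -- Chosen so that ε k ≤ 1/2; the `k + 1` also covers k = 0.
  set ε : ℝ := 1 / (2 * (k + 1)) with hε
  have hεp : 0 < ε := by positivity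
  refine ⟨(1 + 1 / ε) ^ k, by positivity, fun u hu => ?_⟩
  have hu0 : 0 < u := by linarith
  rw [posLog_eq_log (by rwa [abs_of_pos hu0])]
  have h1 : 1 + log u ≤ (1 + 1 / ε) * u ^ ε := by
    have := log_le_rpow_div hu0.le hεp
    have := one_le_rpow hu hεp.le
    rw [add_mul, one_mul, one_div, inv_mul_eq_div]
    linarith
  calc (1 + log u) ^ k ≤ ((1 + 1 / ε) * u ^ ε) ^ k := by
        have := log_nonneg hu
        gcongr
    _ = (1 + 1 / ε) ^ k * u ^ (ε * k) := by rw [mul_pow, ← rpow_mul_natCast hu0.le]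
    _ ≤ _ := by
        gcongr
        · rw [hε, div_mul_eq_mul_div, div_le_div_iff₀ (by positivity) (by positivity)]
          linarith

/-! ### The centred Gaussian density and the kernel (u/v) φ(u). -/

section GaussianKernel

variable {v : NNReal}

lemma gaussianPDFReal_zero_mean (v : NNReal) (x : ℝ) :
    gaussianPDFReal 0 v x = (√(2 * π * v))⁻¹ * exp (-x ^ 2 / (2 * v)) := by
  simp [gaussianPDFReal]

lemma gaussianPDFReal_zero_mean_neg (v : NNReal) (x : ℝ) :
    gaussianPDFReal 0 v (-x) = gaussianPDFReal 0 v x := by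
  simp [gaussianPDFReal]

lemma continuous_gaussianPDFReal_zero_mean (v : NNReal) : Continuous (gaussianPDFReal 0 v) := by
  simp_rw [funext (gaussianPDFReal_zero_mean v)]
  fun_prop

lemma hasDerivAt_gaussianPDFReal (v : NNReal) (x : ℝ) :
    HasDerivAt (gaussianPDFReal 0 v) (-(x / v * gaussianPDFReal 0 v x)) x := by
  have h1 : HasDerivAt (fun x : ℝ => -x ^ 2 / (2 * v)) (-(2 * x) / (2 * v)) x := by
    simpa using ((hasDerivAt_pow 2 x).neg).div_const (2 * (v : ℝ))
  have h := h1.exp.const_mul (√(2 * π * v))⁻¹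
  simp_rw [funext (gaussianPDFReal_zero_mean v)]
  refine h.congr_deriv ?_
  rw [show -(2 * x) / (2 * (v : ℝ)) = -(x / v) by
    rw [neg_div, mul_div_mul_left _ _ two_ne_zero]]
  ring

lemma tendsto_gaussianPDFReal_atTop (hv : v ≠ 0) :
    Tendsto (gaussianPDFReal 0 v) atTop (𝓝 0) := by
  have hv' : (0 : ℝ) < v := by positivity
  have h1 : Tendsto (fun x : ℝ => -(x ^ 2 / (2 * v))) atTop atBot :=
    tendsto_neg_atTop_atBot.comp
      ((tendsto_pow_atTop two_ne_zero).atTop_div_const (by positivity))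
  have h2 := (tendsto_exp_atBot.comp h1).const_mul (√(2 * π * v))⁻¹
  rw [mul_zero] at h2
  refine h2.congr fun x => ?_
  rw [gaussianPDFReal_zero_mean, Function.comp_apply, neg_div]

lemma gaussianKernel_nonneg (v : NNReal) {u : ℝ} (hu : 0 ≤ u) :
    0 ≤ u / v * gaussianPDFReal 0 v u :=
  mul_nonneg (by positivity) (gaussianPDFReal_nonneg _ _ _)

lemma integrableOn_gaussianKernel (hv : v ≠ 0) {a : ℝ} (ha : 0 ≤ a) :
    IntegrableOn (fun u => u / v * gaussianPDFReal 0 v u) (Ioi a) := by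
  refine integrableOn_Ioi_deriv_of_nonneg' (g := fun u => -gaussianPDFReal 0 v u) (l := -0)
    (fun x _ => ?_) (fun x hx => gaussianKernel_nonneg v (ha.trans (le_of_lt hx)))
    (tendsto_gaussianPDFReal_atTop hv).neg
  exact (hasDerivAt_gaussianPDFReal v x).fun_neg.congr_deriv (neg_neg _)

/-- The kernel is the derivative of -φ. The case a = 0 supplies the factor φ(0) in the density
asymptotics. -/
lemma integral_gaussianKernel (hv : v ≠ 0) {a : ℝ} (ha : 0 ≤ a) :
    ∫ u in Ioi a, u / v * gaussianPDFReal 0 v u = gaussianPDFReal 0 v a := by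
  rw [integral_Ioi_of_hasDerivAt_of_tendsto' (f := fun u => -gaussianPDFReal 0 v u) (m := -0)
    (fun x _ => ?_) (integrableOn_gaussianKernel hv ha) (tendsto_gaussianPDFReal_atTop hv).neg]
  · simp
  · exact (hasDerivAt_gaussianPDFReal v x).fun_neg.congr_deriv (neg_neg _)

/-- The Gaussian decay absorbs the factor |x|, so the ratio density is finite and continuous off
zero without any moment assumption on the numerator. -/
lemma exists_abs_mul_gaussianPDFReal_le (hv : v ≠ 0) :
    ∃ C, 0 ≤ C ∧ ∀ x, |x| * gaussianPDFReal 0 v x ≤ C := by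
  have hv' : (0 : ℝ) < v := by positivity
  refine ⟨(√(2 * π * v))⁻¹ * (1 + v), by positivity, fun x => ?_⟩
  rw [gaussianPDFReal_zero_mean, mul_left_comm]
  gcongr
  rw [neg_div, exp_neg, ← div_eq_mul_inv, div_le_iff₀ (exp_pos _)]
  have h1 := add_one_le_exp (x ^ 2 / (2 * v))
  have h2 : (1 + (v : ℝ)) * (x ^ 2 / (2 * v) + 1) = x ^ 2 / (2 * v) + x ^ 2 / 2 + 1 + v := by
    field_simp
    ring
  have h3 : |x| ≤ x ^ 2 / 2 + 1 := by
    nlinarith [sq_abs x, sq_nonneg (|x| - 1)]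
  have h4 : 0 ≤ x ^ 2 / (2 * (v : ℝ)) := by positivity
  calc |x| ≤ (1 + (v : ℝ)) * (x ^ 2 / (2 * v) + 1) := by rw [h2]; linarith
    _ ≤ _ := by gcongr

lemma integrable_pow_mul_gaussianPDFReal (hv : v ≠ 0) (n : ℕ) :
    Integrable (fun x => x ^ n * gaussianPDFReal 0 v x) := by
  have hv' : (0 : ℝ) < v := by positivity
  have h := (integrable_rpow_mul_exp_neg_mul_sq (b := 1 / (2 * v)) (by positivity)
    (s := n) (by linarith [n.cast_nonneg (α := ℝ)])).const_mul (√(2 * π * v))⁻¹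
  refine h.congr (Eventually.of_forall fun x => ?_)
  simp only [rpow_natCast, gaussianPDFReal_zero_mean]
  rw [mul_left_comm]
  congr 3
  ring

lemma integrableOn_gaussianKernel_mul_posLog_pow (hv : v ≠ 0) (k : ℕ) :
    IntegrableOn (fun u => u / v * gaussianPDFReal 0 v u * (1 + log⁺ u) ^ k) (Ioi 0) := by
  obtain ⟨C, hC0, hC⟩ := exists_one_add_posLog_pow_le k
  have hC1 : 1 ≤ C := by simpa using hC 1 le_rfl
  have hdom : Integrable
      (fun u : ℝ => C / v * (u ^ 1 * gaussianPDFReal 0 v u + u ^ 2 * gaussianPDFReal 0 v u)) :=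
    ((integrable_pow_mul_gaussianPDFReal hv 1).add
      (integrable_pow_mul_gaussianPDFReal hv 2)).const_mul _
  refine hdom.integrableOn.mono' ?_ ?_
  · have := continuous_gaussianPDFReal_zero_mean v
    have := continuous_posLog
    exact Continuous.aestronglyMeasurable (by fun_prop)
  · filter_upwards [ae_restrict_mem measurableSet_Ioi] with u (hu : 0 < u)
    have hlog := posLog_nonneg (x := u)
    have hw := gaussianKernel_nonneg v hu.le
    rw [norm_eq_abs, abs_of_nonneg (by positivity)]
    have hle : (1 + log⁺ u) ^ k ≤ C * (1 + u) := by
      rcases le_total 1 u with h1 | h1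
      · refine (hC u h1).trans ?_
        gcongr
        calc u ^ (1 / 2 : ℝ) ≤ u ^ (1 : ℝ) := rpow_le_rpow_of_exponent_le h1 (by norm_num)
          _ ≤ 1 + u := by rw [rpow_one]; linarith
      · rw [(posLog_eq_zero_iff u).2 (by rwa [abs_of_pos hu])]
        simp only [add_zero, one_pow]
        nlinarith
    calc u / v * gaussianPDFReal 0 v u * (1 + log⁺ u) ^ k
        ≤ u / v * gaussianPDFReal 0 v u * (C * (1 + u)) := by gcongr
      _ = _ := by ring

/-- By symmetry this is 2v times the total mass of the kernel on the positive half-line. -/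
lemma integral_abs_gaussianReal (hv : v ≠ 0) :
    ∫ x, |x| ∂gaussianReal 0 v = 2 * v * gaussianPDFReal 0 v 0 := by
  have hv' : (v : ℝ) ≠ 0 := by positivity
  rw [integral_gaussianReal_eq_integral_smul hv]
  have h : ∀ x : ℝ, gaussianPDFReal 0 v x • |x| = v * (|x| / v * gaussianPDFReal 0 v |x|) := by
    intro x
    have : gaussianPDFReal 0 v |x| = gaussianPDFReal 0 v x := by
      simp [gaussianPDFReal_zero_mean]
    rw [this, smul_eq_mul]
    field_simp
  simp_rw [h]
  rw [integral_comp_abs (f := fun x => v * (x / v * gaussianPDFReal 0 v x)), integral_const_mul,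
    integral_gaussianKernel hv le_rfl, mul_assoc]

lemma two_mul_gaussianPDFReal_zero {s : ℝ} (hs : 0 < s) :
    2 * gaussianPDFReal 0 (s ^ 2).toNNReal 0 = √(2 / π) / s := by
  rw [gaussianPDFReal_zero_mean, coe_toNNReal _ (sq_nonneg s), sqrt_mul (by positivity),
    sqrt_sq hs.le, sqrt_mul zero_le_two, sqrt_div zero_le_two]
  simp only [ne_eq, OfNat.ofNat_ne_zero, not_false_eq_true, zero_pow, neg_zero, zero_div, exp_zero,
    mul_one]
  have h2 : √2 * √2 = 2 := mul_self_sqrt zero_le_two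
  have := sqrt_pos.2 pi_pos
  field_simp
  linarith

end GaussianKernel

/-! ### The density of a quotient by a Gaussian variable. -/

/-- The density of `V / Y` for independent `V`, of law `μ`, and `Y`, centred Gaussian of
variance `v`. -/
noncomputable def gaussianRatioDensity (μ : Measure ℝ) (v : NNReal) (z : ℝ) : ℝ :=
  (z ^ 2)⁻¹ * ∫ x, |x| * gaussianPDFReal 0 v (x / z) ∂μ

section GaussianRatio

variable {μ : Measure ℝ} {v : NNReal}

lemma gaussianRatioDensity_nonneg (z : ℝ) : 0 ≤ gaussianRatioDensity μ v z :=
  mul_nonneg (by positivity) (integral_nonneg fun x =>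
    mul_nonneg (abs_nonneg x) (gaussianPDFReal_nonneg _ _ _))

lemma gaussianRatioDensity_neg (z : ℝ) :
    gaussianRatioDensity μ v (-z) = gaussianRatioDensity μ v z := by
  simp [gaussianRatioDensity, div_neg, gaussianPDFReal_zero_mean_neg]

lemma gaussianRatioDensity_abs (z : ℝ) :
    gaussianRatioDensity μ v |z| = gaussianRatioDensity μ v z := by
  rcases abs_choice z with h | h <;> rw [h]
  exact gaussianRatioDensity_neg z

lemma abs_mul_gaussianPDFReal_div_le {C : ℝ} (hC : ∀ x, |x| * gaussianPDFReal 0 v x ≤ C)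
    {z : ℝ} (hz : z ≠ 0) (x : ℝ) : |x| * gaussianPDFReal 0 v (x / z) ≤ C * |z| := by
  have hz' : 0 < |z| := abs_pos.2 hz
  have := hC (x / z)
  rw [abs_div, div_mul_eq_mul_div, div_le_iff₀ hz'] at this
  exact this

lemma integrable_abs_mul_gaussianPDFReal_div [IsFiniteMeasure μ] (hv : v ≠ 0) {z : ℝ}
    (hz : z ≠ 0) : Integrable (fun x => |x| * gaussianPDFReal 0 v (x / z)) μ := by
  obtain ⟨C, -, hC⟩ := exists_abs_mul_gaussianPDFReal_le hv
  have := continuous_gaussianPDFReal_zero_mean v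
  refine (integrable_const (C * |z|)).mono' (Continuous.aestronglyMeasurable (by fun_prop))
    (Eventually.of_forall fun x => ?_)
  rw [norm_eq_abs, abs_of_nonneg (mul_nonneg (abs_nonneg x) (gaussianPDFReal_nonneg _ _ _))]
  exact abs_mul_gaussianPDFReal_div_le hC hz x

lemma continuousOn_gaussianRatioDensity [IsFiniteMeasure μ] (hv : v ≠ 0) :
    ContinuousOn (gaussianRatioDensity μ v) {0}ᶜ := by
  obtain ⟨C, hC0, hC⟩ := exists_abs_mul_gaussianPDFReal_le hv
  have hcont := continuous_gaussianPDFReal_zero_mean v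
  intro z (hz : z ≠ 0)
  refine ContinuousAt.continuousWithinAt ?_
  refine ((continuousAt_id.pow 2).inv₀ (by simpa using hz)).mul ?_
  refine continuousAt_of_dominated (bound := fun _ => C * (|z| + 1)) ?_ ?_ (integrable_const _) ?_
  · exact Eventually.of_forall fun y => Continuous.aestronglyMeasurable (by fun_prop)
  · filter_upwards [isOpen_ne.mem_nhds hz,
      continuous_abs.continuousAt.eventually_lt_const (lt_add_one |z|)] with y hy hy'
    refine Eventually.of_forall fun x => ?_
    rw [norm_eq_abs, abs_of_nonneg (mul_nonneg (abs_nonneg x) (gaussianPDFReal_nonneg _ _ _))]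
    refine (abs_mul_gaussianPDFReal_div_le hC hy x).trans ?_
    gcongr
  · refine Eventually.of_forall fun x => ?_
    exact continuousAt_const.mul
      (hcont.continuousAt.comp (continuousAt_const.div continuousAt_id hz))

lemma measurable_gaussianRatioDensity [SFinite μ] : Measurable (gaussianRatioDensity μ v) := by
  have h : Measurable (Function.uncurry fun z x : ℝ => |x| * gaussianPDFReal 0 v (x / z)) :=
    (measurable_snd.abs).mul
      ((measurable_gaussianPDFReal 0 v).comp (measurable_snd.div measurable_fst))
  exact (measurable_id.pow_const 2).inv.mul
    (h.stronglyMeasurable.integral_prod_right (ν := μ)).measurable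

/-- The law of a nonzero constant divided by a centred Gaussian variable. -/
lemma lintegral_gaussianPDF_div (hv : v ≠ 0) {x : ℝ} (hx : x ≠ 0) (h : ℝ → ENNReal) :
    ∫⁻ y, h (x / y) ∂(gaussianReal 0 v) =
      ∫⁻ z, ENNReal.ofReal ((z ^ 2)⁻¹ * (|x| * gaussianPDFReal 0 v (x / z))) * h z := by
  have hmeas : MeasurableSet ({0}ᶜ : Set ℝ) := (measurableSet_singleton 0).compl
  -- The map z ↦ x / z is an involution of the nonzero reals, so the change of variables needs no
  -- splitting by sign.
  have him : (fun z => x / z) '' ({0}ᶜ : Set ℝ) = {0}ᶜ := by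
    ext y
    simp only [mem_image, mem_compl_iff, mem_singleton_iff]
    constructor
    · rintro ⟨z, hz, rfl⟩
      exact div_ne_zero hx hz
    · intro hy
      exact ⟨x / y, div_ne_zero hx hy, div_div_cancel₀ hx⟩
  have hder : ∀ z ∈ ({0}ᶜ : Set ℝ),
      HasDerivWithinAt (fun z => x / z) (-x / z ^ 2) {0}ᶜ z := by
    intro z hz
    have := (hasDerivAt_inv (show z ≠ 0 from hz)).const_mul x
    refine (this.congr_deriv ?_).hasDerivWithinAt.congr_of_mem (fun y _ => ?_) hz
    · ring
    · exact div_eq_mul_inv _ _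
  have hinj : InjOn (fun z => x / z) ({0}ᶜ : Set ℝ) := by
    intro a ha b hb hab
    have : x / (x / a) = x / (x / b) := congrArg (fun t => x / t) hab
    rwa [div_div_cancel₀ hx, div_div_cancel₀ hx] at this
  rw [gaussianReal_of_var_ne_zero _ hv,
    lintegral_withDensity_eq_lintegral_mul_non_measurable _ (measurable_gaussianPDF 0 v)
      (Eventually.of_forall fun _ => gaussianPDF_lt_top), ← restrict_compl_singleton (μ := volume)
      (0 : ℝ)]
  conv_lhs => rw [← him]
  rw [lintegral_image_eq_lintegral_abs_deriv_mul hmeas hder hinj]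
  refine setLIntegral_congr_fun hmeas fun z hz => ?_
  simp only [Pi.mul_apply, gaussianPDF]
  rw [div_div_cancel₀ hx, ← mul_assoc, ← ENNReal.ofReal_mul (abs_nonneg _), abs_div, abs_neg,
    abs_of_nonneg (sq_nonneg z)]
  congr 2
  ring

/-- Tonelli over the numerator reduces this to a constant numerator. An atom of `μ` at 0 would
produce an atom of the quotient, hence `hμ`. -/
lemma map_div_prod_gaussianReal [IsFiniteMeasure μ] (hμ : μ {0} = 0) (hv : v ≠ 0) :
    (μ.prod (gaussianReal 0 v)).map (fun p => p.1 / p.2) =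
      volume.withDensity fun z => ENNReal.ofReal (gaussianRatioDensity μ v z) := by
  have hdiv : Measurable fun p : ℝ × ℝ => p.1 / p.2 := measurable_fst.div measurable_snd
  ext A hA
  have hAi : Measurable (A.indicator (1 : ℝ → ENNReal)) := measurable_one.indicator hA
  have hne : ∀ᵐ x ∂μ, x ≠ 0 := by rwa [ae_iff, show {a : ℝ | ¬a ≠ 0} = {0} by ext; simp]
  have hk : Measurable fun p : ℝ × ℝ =>
      ENNReal.ofReal ((p.2 ^ 2)⁻¹ * (|p.1| * gaussianPDFReal 0 v (p.1 / p.2))) :=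
    ((measurable_snd.pow_const 2).inv.mul (measurable_fst.abs.mul
      ((measurable_gaussianPDFReal 0 v).comp hdiv))).ennreal_ofReal
  rw [withDensity_apply _ hA, ← lintegral_indicator_one hA, lintegral_map hAi hdiv,
    lintegral_prod (fun p : ℝ × ℝ => A.indicator 1 (p.1 / p.2)) (hAi.comp hdiv).aemeasurable]
  calc ∫⁻ x, ∫⁻ y, A.indicator 1 (x / y) ∂(gaussianReal 0 v) ∂μ
      = ∫⁻ x, (∫⁻ z, ENNReal.ofReal ((z ^ 2)⁻¹ * (|x| * gaussianPDFReal 0 v (x / z))) *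
          A.indicator 1 z) ∂μ := by
        refine lintegral_congr_ae ?_
        filter_upwards [hne] with x hx
        exact lintegral_gaussianPDF_div hv hx _
    _ = ∫⁻ z, ∫⁻ x, ENNReal.ofReal ((z ^ 2)⁻¹ * (|x| * gaussianPDFReal 0 v (x / z))) *
          A.indicator 1 z ∂μ :=
        lintegral_lintegral_swap (hk.mul (hAi.comp measurable_snd)).aemeasurable
    _ = ∫⁻ z, A.indicator (fun z => ENNReal.ofReal (gaussianRatioDensity μ v z)) z := by
        refine lintegral_congr_ae ?_
        filter_upwards [compl_mem_ae_iff.2 (measure_singleton (μ := volume) (0 : ℝ))] with z hz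
        have hkz : Measurable fun x =>
            ENNReal.ofReal ((z ^ 2)⁻¹ * (|x| * gaussianPDFReal 0 v (x / z))) :=
          hk.comp (measurable_id.prodMk measurable_const)
        rw [lintegral_mul_const _ hkz,
          ← ofReal_integral_eq_lintegral_ofReal
            ((integrable_abs_mul_gaussianPDFReal_div hv hz).const_mul _)
            (Eventually.of_forall fun x => mul_nonneg (by positivity)
              (mul_nonneg (abs_nonneg x) (gaussianPDFReal_nonneg _ _ _))), integral_const_mul]
        by_cases hzA : z ∈ A <;> simp [hzA, gaussianRatioDensity]
    _ = ∫⁻ z in A, ENNReal.ofReal (gaussianRatioDensity μ v z) := lintegral_indicator hA _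

end GaussianRatio

lemma LogGrowth.congr {k : ℕ} {B : ℝ} {F G : ℝ → ℝ} (h : LogGrowth k B F) (hG : Measurable G)
    (hFG : ∀ x, 0 < x → F x = G x) : LogGrowth k B G := by
  refine ⟨hG, h.tendsto.congr' ?_, ?_⟩
  · filter_upwards [eventually_gt_atTop 0] with x hx
    rw [hFG x hx]
  · obtain ⟨C, hC⟩ := h.bound
    exact ⟨C, fun x hx => hFG x hx ▸ hC x hx⟩

/-! ### Truncated moments and the layer-cake formula. -/

/-- The absolute first moment of `μ` truncated at level `x`. -/
noncomputable def truncatedAbsMoment (μ : Measure ℝ) (x : ℝ) : ℝ :=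
  ∫ y in Icc (-x) x, |y| ∂μ

section TruncatedMoment

variable {μ : Measure ℝ}

lemma integrableOn_abs_Icc [IsFiniteMeasure μ] (a b : ℝ) :
    IntegrableOn (fun y : ℝ => |y|) (Icc a b) μ :=
  continuous_abs.continuousOn.integrableOn_compact isCompact_Icc

lemma truncatedAbsMoment_nonneg (x : ℝ) : 0 ≤ truncatedAbsMoment μ x :=
  integral_nonneg fun y => abs_nonneg y

lemma monotone_truncatedAbsMoment [IsFiniteMeasure μ] : Monotone (truncatedAbsMoment μ) := by
  intro a b hab
  exact setIntegral_mono_set (integrableOn_abs_Icc _ _)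
    (Eventually.of_forall fun y => abs_nonneg y)
    (Icc_subset_Icc (neg_le_neg hab) hab).eventuallyLE

lemma tendsto_truncatedAbsMoment (h : Integrable (fun y => |y|) μ) :
    Tendsto (truncatedAbsMoment μ) atTop (𝓝 (∫ y, |y| ∂μ)) := by
  have hU : ⋃ x : ℝ, Icc (-x) x = univ :=
    eq_univ_of_forall fun y => mem_iUnion.2 ⟨|y|, neg_abs_le y, le_abs_self y⟩
  have := tendsto_setIntegral_of_monotone (μ := μ) (f := fun y : ℝ => |y|)
    (s := fun x : ℝ => Icc (-x) x) (fun _ => measurableSet_Icc)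
    (fun a b hab => Icc_subset_Icc (neg_le_neg hab) hab) h.integrableOn
  rwa [hU, setIntegral_univ] at this

variable {v : NNReal}

/-- The layer-cake formula expressing the ratio density by truncated moments. -/
lemma integral_abs_mul_gaussianPDFReal_div [IsFiniteMeasure μ] (hv : v ≠ 0) {z : ℝ} (hz : 0 < z) :
    ∫ x, |x| * gaussianPDFReal 0 v (x / z) ∂μ =
      ∫ u in Ioi 0, u / v * gaussianPDFReal 0 v u * truncatedAbsMoment μ (z * u) := by
  set w : ℝ → ℝ := fun u => u / v * gaussianPDFReal 0 v u with hw
  have hwc : Continuous w := by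
    have := continuous_gaussianPDFReal_zero_mean v
    fun_prop
  set S : Set (ℝ × ℝ) := {p | |p.1| ≤ z * p.2} with hS
  have hSm : MeasurableSet S := measurableSet_le measurable_fst.abs (measurable_snd.const_mul z)
  -- Integrating K over u > 0 gives |x| φ(|x|/z); integrating it over x gives w(u) times the
  -- truncated moment at zu.
  set K : ℝ → ℝ → ℝ := fun x u => S.indicator (fun p => |p.1| * w p.2) (x, u) with hK
  have hKint : Integrable (Function.uncurry K) (μ.prod (volume.restrict (Ioi 0))) := by
    -- On S, |x| ≤ zu, so K ≤ z u w(u). This bound is free of x and hence integrable for any finite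
    -- `μ`.
    have hdom : Integrable (fun p : ℝ × ℝ => (1 : ℝ) * (z / v * (p.2 ^ 2 * gaussianPDFReal 0 v p.2)))
        (μ.prod (volume.restrict (Ioi 0))) :=
      (integrable_const (1 : ℝ)).mul_prod
        (((integrable_pow_mul_gaussianPDFReal hv 2).const_mul (z / v)).integrableOn)
    refine hdom.mono' ?_ ?_
    · exact ((measurable_fst.abs.mul (hwc.measurable.comp measurable_snd)).indicator
        hSm).aestronglyMeasurable
    · have hpos : ∀ᵐ p ∂(μ.prod (volume.restrict (Ioi (0 : ℝ)))), 0 < p.2 :=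
        Measure.quasiMeasurePreserving_snd.ae (ae_restrict_mem measurableSet_Ioi)
      filter_upwards [hpos] with p hp
      have hw0 : 0 ≤ w p.2 := gaussianKernel_nonneg v hp.le
      have hr : (1 : ℝ) * (z / v * (p.2 ^ 2 * gaussianPDFReal 0 v p.2)) = z * p.2 * w p.2 := by
        rw [hw]; ring
      rw [hr]
      change ‖S.indicator (fun p => |p.1| * w p.2) p‖ ≤ _
      by_cases hpS : p ∈ S
      · rw [indicator_of_mem hpS, norm_eq_abs, abs_of_nonneg (by positivity)]
        gcongr
        exact hpS
      · rw [indicator_of_notMem hpS, norm_zero]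
        positivity
  have h1 : ∀ x, ∫ u in Ioi 0, K x u = |x| * gaussianPDFReal 0 v (x / z) := by
    intro x
    have hae : ∀ u, K x u = (Ici (|x| / z)).indicator (fun u => |x| * w u) u := by
      intro u
      simp only [hK, hS, indicator_apply, mem_ofPred_eq, mem_Ici, div_le_iff₀' hz]
    have hsets : (Ici (|x| / z) ∩ Ioi 0 : Set ℝ) =ᵐ[volume] Ioi (|x| / z) := by
      have h0 : 0 ≤ |x| / z := by positivity
      have : Ioi (|x| / z) ∩ Ioi 0 = Ioi (|x| / z) :=
        inter_eq_left.2 (Ioi_subset_Ioi h0)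
      conv_rhs => rw [← this]
      exact ae_eq_set_inter Ioi_ae_eq_Ici.symm (ae_eq_refl _)
    simp_rw [hae]
    rw [integral_indicator measurableSet_Ici, Measure.restrict_restrict measurableSet_Ici,
      setIntegral_congr_set hsets, integral_const_mul,
      integral_gaussianKernel hv (by positivity)]
    congr 1
    rcases abs_choice x with h | h <;> rw [h]
    rw [neg_div, gaussianPDFReal_zero_mean_neg]
  have h2 : ∀ u, ∫ x, K x u ∂μ = w u * truncatedAbsMoment μ (z * u) := by
    intro u
    have hae : ∀ x, K x u = (Icc (-(z * u)) (z * u)).indicator (fun x => |x| * w u) x := by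
      intro x
      simp only [hK, hS, indicator_apply, mem_ofPred_eq, mem_Icc, abs_le]
    simp_rw [hae]
    rw [integral_indicator measurableSet_Icc, integral_mul_const, mul_comm]
    rfl
  simp_rw [← h1]
  rw [integral_integral_swap hKint]
  exact integral_congr_ae (Eventually.of_forall h2)

/-- The asymptotics of the ratio density in terms of the truncated moment of the numerator. -/
lemma logGrowth_sq_mul_gaussianRatioDensity [IsFiniteMeasure μ] (hv : v ≠ 0) {k : ℕ} {B : ℝ}
    (h : LogGrowth k B (truncatedAbsMoment μ)) :
    LogGrowth k (gaussianPDFReal 0 v 0 * B) (fun z => z ^ 2 * gaussianRatioDensity μ v z) := by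
  have hw : Measurable fun u => u / v * gaussianPDFReal 0 v u :=
    (measurable_id.div_const _).mul (measurable_gaussianPDFReal 0 v)
  have h1 := h.integral_dilation hw (integrableOn_gaussianKernel_mul_posLog_pow hv k)
  rw [integral_gaussianKernel hv le_rfl] at h1
  refine h1.congr ((measurable_id.pow_const 2).mul measurable_gaussianRatioDensity) ?_
  intro z hz
  rw [← integral_abs_mul_gaussianPDFReal_div hv hz, gaussianRatioDensity,
    mul_inv_cancel_left₀ (by positivity)]

end TruncatedMoment

/-! ### From density asymptotics to truncated moments and tails. -/

section Density

variable {f : ℝ → ℝ} {k : ℕ} {A : ℝ}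

/-- An even density with `z ^ 2 * f z ~ A * log z ^ k` has truncated moment of one
logarithmic order more. -/
lemma logGrowth_truncatedAbsMoment_withDensity (hf0 : ∀ z, 0 ≤ f z) (hfi : Integrable f)
    (hfm : Measurable f) (hfe : ∀ z, f |z| = f z) (h : LogGrowth k A (fun z => z ^ 2 * f z)) :
    LogGrowth (k + 1) (2 * A / (k + 1))
      (truncatedAbsMoment (volume.withDensity fun z => ENNReal.ofReal (f z))) := by
  set ν := volume.withDensity fun z => ENNReal.ofReal (f z) with hν
  have : IsFiniteMeasure ν := isFiniteMeasure_withDensity_ofReal hfi.2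
  refine LogGrowth.of_monotone monotone_truncatedAbsMoment truncatedAbsMoment_nonneg ?_
  have hint : ∀ a z, 0 ≤ a → IntegrableOn (fun y => f y * y) (Ioc a z) := by
    intro a z ha
    refine ((hfi.mul_const z).integrableOn (s := Ioc a z)).mono'
      (hfm.mul measurable_id).aestronglyMeasurable ?_
    filter_upwards [ae_restrict_mem measurableSet_Ioc] with y hy
    have hy0 : 0 ≤ y := ha.trans hy.1.le
    rw [norm_eq_abs, abs_of_nonneg (mul_nonneg (hf0 y) hy0)]
    exact mul_le_mul_of_nonneg_left hy.2 (hf0 y)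
  have hL : ∀ z, truncatedAbsMoment ν z = 2 * ∫ y in Ioc 0 z, f y * y := by
    intro z
    have h1 : truncatedAbsMoment ν z = ∫ y in Icc (-z) z, f y * |y| := by
      rw [truncatedAbsMoment, hν, setIntegral_withDensity_eq_setIntegral_toReal_smul
        hfm.ennreal_ofReal (Eventually.of_forall fun _ => ENNReal.ofReal_lt_top) _
        measurableSet_Icc]
      simp_rw [ENNReal.toReal_ofReal (hf0 _), smul_eq_mul]
    have h2 : ∀ y, (Icc (-z) z).indicator (fun y => f y * |y|) y =
        (fun y => (Iic z).indicator (fun y => f y * y) y) |y| := by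
      intro y
      simp only [indicator_apply, mem_Icc, mem_Iic, ← abs_le, hfe]
    rw [h1, ← integral_indicator measurableSet_Icc]
    simp_rw [h2]
    rw [integral_comp_abs (f := fun y => (Iic z).indicator (fun y => f y * y) y),
      integral_indicator measurableSet_Iic, Measure.restrict_restrict measurableSet_Iic,
      inter_comm, Ioi_inter_Iic]
  have hlog : Tendsto (fun z => log z ^ (k + 1)) atTop atTop :=
    (tendsto_pow_atTop k.succ_ne_zero).comp tendsto_log_atTop
  -- The part over (0, 1] is constant in z and vanishes after division by the diverging logarithm;
  -- only (1, z] matters.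
  have hsum := ((tendsto_const_nhds (x := 2 * ∫ y in Ioc 0 1, f y * y)).div_atTop hlog).add
    (h.tendsto_integral_div.const_mul 2)
  rw [zero_add, ← mul_div_assoc] at hsum
  refine hsum.congr' ?_
  filter_upwards [eventually_ge_atTop 1] with z hz
  have hg : ∫ x in Ioc 1 z, x ^ 2 * f x / x = ∫ y in Ioc 1 z, f y * y := by
    refine setIntegral_congr_fun measurableSet_Ioc fun y hy => ?_
    have : y ≠ 0 := by linarith [hy.1]
    field_simp
  rw [hL, ← Ioc_union_Ioc_eq_Ioc zero_le_one hz, setIntegral_union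
    (Ioc_disjoint_Ioc_of_le le_rfl) measurableSet_Ioc (hint 0 1 le_rfl) (hint 1 z zero_le_one), hg]
  ring

lemma integrableOn_inv_sq_mul_posLog_pow (k : ℕ) :
    IntegrableOn (fun u : ℝ => (u ^ 2)⁻¹ * (1 + log⁺ u) ^ k) (Ioi 1) := by
  obtain ⟨C, -, hC⟩ := exists_one_add_posLog_pow_le k
  have hdom := (integrableOn_Ioi_rpow_of_lt (a := -3 / 2) (by norm_num) zero_lt_one).const_mul C
  refine hdom.mono' ?_ ?_
  · have := continuous_posLog.measurable
    exact Measurable.aestronglyMeasurable (by fun_prop)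
  · filter_upwards [ae_restrict_mem measurableSet_Ioi] with u (hu : 1 < u)
    have hu0 : 0 < u := by linarith
    have := posLog_nonneg (x := u)
    rw [norm_eq_abs, abs_of_nonneg (by positivity)]
    calc (u ^ 2)⁻¹ * (1 + log⁺ u) ^ k ≤ (u ^ 2)⁻¹ * (C * u ^ (1 / 2 : ℝ)) := by
          gcongr; exact hC u hu.le
      _ = C * u ^ (-3 / 2 : ℝ) := by
          rw [← rpow_two, ← rpow_neg hu0.le, mul_left_comm, ← rpow_add hu0]
          norm_num

lemma integral_Ioi_one_inv_sq : ∫ u in Ioi (1 : ℝ), (u ^ 2)⁻¹ = 1 := by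
  have h := integral_Ioi_rpow_of_lt (a := -2) (by norm_num) zero_lt_one
  norm_num at h
  exact h

/-- Integrating `f z ~ A * log z ^ k / z ^ 2` over the tail. -/
lemma tendsto_integral_Ioi_of_logGrowth (h : LogGrowth k A (fun z => z ^ 2 * f z)) :
    Tendsto (fun z => (z * ∫ x in Ioi z, f x) / log z ^ k) atTop (𝓝 A) := by
  -- With this weight the dilation average of z² f(z) is ∫₁^∞ u⁻² (zu)² f(zu) du, that is, z times
  -- the tail integral of f.
  have hw : Measurable ((Ioi 1).indicator fun u : ℝ => (u ^ 2)⁻¹) :=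
    (measurable_id.pow_const 2).inv.indicator measurableSet_Ioi
  have hset : Ioi (1 : ℝ) ∩ Ioi 0 = Ioi 1 := inter_eq_left.2 (Ioi_subset_Ioi zero_le_one)
  have hred : ∀ F : ℝ → ℝ, ∫ u in Ioi 0, (Ioi 1).indicator (fun u : ℝ => (u ^ 2)⁻¹) u * F u =
      ∫ u in Ioi 1, (u ^ 2)⁻¹ * F u := by
    intro F
    simp_rw [← indicator_mul_left (Ioi (1 : ℝ)) (fun u : ℝ => (u ^ 2)⁻¹) F]
    rw [integral_indicator measurableSet_Ioi, Measure.restrict_restrict measurableSet_Ioi, hset]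
  have hint : IntegrableOn
      (fun u => (Ioi 1).indicator (fun u : ℝ => (u ^ 2)⁻¹) u * (1 + log⁺ u) ^ k) (Ioi 0) := by
    simp_rw [← indicator_mul_left (Ioi (1 : ℝ)) (fun u : ℝ => (u ^ 2)⁻¹)
      (fun u => (1 + log⁺ u) ^ k)]
    exact ((integrable_indicator_iff measurableSet_Ioi).2
      (integrableOn_inv_sq_mul_posLog_pow k)).integrableOn
  have h1 := (h.integral_dilation hw hint).tendsto
  have h2 := hred fun _ => 1
  simp only [mul_one] at h2
  rw [h2, integral_Ioi_one_inv_sq, one_mul] at h1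
  refine h1.congr' ?_
  filter_upwards [eventually_gt_atTop 0] with z hz
  rw [hred fun u => (z * u) ^ 2 * f (z * u)]
  congr 1
  have h3 : ∫ u in Ioi 1, (u ^ 2)⁻¹ * ((z * u) ^ 2 * f (z * u)) =
      ∫ u in Ioi 1, z ^ 2 * f (z * u) := by
    refine setIntegral_congr_fun measurableSet_Ioi fun u (hu : 1 < u) => ?_
    have : u ≠ 0 := by linarith
    field_simp
  rw [h3, integral_const_mul, integral_comp_mul_left_Ioi f 1 hz, mul_one, smul_eq_mul]
  field_simp

end Density

/-! ### Probabilistic assembly: induction on the denominators, the constant, uniqueness. -/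

lemma productRatio_succ {Ω : Type*} {M n : ℕ} (X : Fin M → Ω → ℝ) (Y : Fin (n + 1) → Ω → ℝ) :
    productRatio X Y =
      fun ω => productRatio X (fun j => Y j.castSucc) ω / Y (Fin.last n) ω := by
  funext ω
  simp only [productRatio, Fin.prod_univ_castSucc, div_div]

section Probability

variable {Ω : Type*} [MeasurableSpace Ω] {P : Measure Ω}

lemma toNNReal_sq_ne_zero {s : ℝ} (hs : 0 < s) : (s ^ 2).toNNReal ≠ 0 :=
  (toNNReal_pos.2 (by positivity)).ne'

lemma ae_ne_zero_of_hasLaw_gaussianReal {Y : Ω → ℝ} {v : NNReal} (hv : v ≠ 0)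
    (hY : HasLaw Y (gaussianReal 0 v) P) : ∀ᵐ ω ∂P, Y ω ≠ 0 := by
  rw [hY.ae_iff (p := fun y => y ≠ 0) (by fun_prop), ae_iff]
  simpa using gaussianReal_absolutelyContinuous 0 hv (measure_singleton (μ := volume) (0 : ℝ))

lemma integral_abs_of_hasLaw_gaussianReal {X : Ω → ℝ} {σ : ℝ} (hσ : 0 < σ)
    (hX : HasLaw X (gaussianReal 0 (σ ^ 2).toNNReal) P) :
    ∫ ω, |X ω| ∂P = √(2 / π) * σ := by
  have h := hX.integral_comp (f := fun x => |x|) continuous_abs.aestronglyMeasurable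
  rw [Function.comp_def] at h
  rw [h, integral_abs_gaussianReal (toNNReal_sq_ne_zero hσ), mul_right_comm,
    two_mul_gaussianPDFReal_zero hσ, coe_toNNReal _ (sq_nonneg σ)]
  field_simp

lemma aemeasurable_productRatio {M N : ℕ} {X : Fin M → Ω → ℝ} {Y : Fin N → Ω → ℝ}
    (hX : ∀ i, AEMeasurable (X i) P) (hY : ∀ j, AEMeasurable (Y j) P) :
    AEMeasurable (productRatio X Y) P :=
  (Finset.aemeasurable_fun_prod _ fun i _ => hX i).div
    (Finset.aemeasurable_fun_prod _ fun j _ => hY j)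

lemma indepFun_productRatio_last {M n : ℕ} {X : Fin M → Ω → ℝ} {Y : Fin (n + 1) → Ω → ℝ}
    (hX : ∀ i, AEMeasurable (X i) P) (hY : ∀ j, AEMeasurable (Y j) P)
    (h : iIndepFun (Sum.elim X Y) P) :
    IndepFun (productRatio X fun j => Y j.castSucc) (Y (Fin.last n)) P := by
  classical
  set S : Finset (Fin M ⊕ Fin (n + 1)) := Finset.univ.erase (Sum.inr (Fin.last n)) with hS
  set T : Finset (Fin M ⊕ Fin (n + 1)) := {Sum.inr (Fin.last n)} with hT
  have hST : Disjoint S T := by simp [hS, hT]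
  have hXS : ∀ i, Sum.inl i ∈ S := fun i => by simp [hS]
  have hYS : ∀ j : Fin n, Sum.inr j.castSucc ∈ S := fun j => by
    simp [hS, (Fin.castSucc_lt_last j).ne]
  have hmeas : ∀ i, AEMeasurable (Sum.elim X Y i) P := by
    rintro (i | j)
    exacts [hX i, hY j]
  have hind := h.indepFun_finset₀ S T hST hmeas
  have hφ : Measurable fun p : S → ℝ =>
      (∏ i : Fin M, p ⟨Sum.inl i, hXS i⟩) / ∏ j : Fin n, p ⟨Sum.inr j.castSucc, hYS j⟩ := by
    fun_prop
  have hψ : Measurable fun p : T → ℝ => p ⟨Sum.inr (Fin.last n), by simp [hT]⟩ := by fun_prop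
  exact hind.comp hφ hψ

lemma iIndepFun.sumElim_castSucc {M n : ℕ} {X : Fin M → Ω → ℝ} {Y : Fin (n + 1) → Ω → ℝ}
    (h : iIndepFun (Sum.elim X Y) P) :
    iIndepFun (Sum.elim X fun j : Fin n => Y j.castSucc) P := by
  have := h.precomp (g := Sum.map id Fin.castSucc)
    (Function.injective_id.sumMap (Fin.castSucc_injective n))
  convert! this using 1
  funext i
  cases i <;> rfl

variable [IsProbabilityMeasure P]

/-- The ratio by an independent centred Gaussian variable has the expected density. -/
lemma hasLaw_div_gaussianReal {V Y : Ω → ℝ} {v : NNReal} (hv : v ≠ 0) (hV : AEMeasurable V P)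
    (hV0 : P.map V {0} = 0) (hY : HasLaw Y (gaussianReal 0 v) P) (hVY : IndepFun V Y P) :
    HasLaw (fun ω => V ω / Y ω)
      (volume.withDensity fun z => ENNReal.ofReal (gaussianRatioDensity (P.map V) v z)) P where
  aemeasurable := hV.div hY.aemeasurable
  map_eq := by
    have := Measure.isProbabilityMeasure_map (μ := P) hV
    have hdiv : Measurable fun p : ℝ × ℝ => p.1 / p.2 := measurable_fst.div measurable_snd
    rw [← map_div_prod_gaussianReal hV0 hv, ← hY.map_eq,
      ← (indepFun_iff_map_prod_eq_prod_map_map hV hY.aemeasurable).1 hVY,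
      AEMeasurable.map_map_of_aemeasurable hdiv.aemeasurable (hV.prodMk hY.aemeasurable)]
    rfl

/-- The limit of `E[|Z|; |Z| ≤ x] / log x ^ N` as `x → ∞`. -/
noncomputable def truncatedMomentConstant {M N : ℕ} (σ : Fin M → ℝ) (s : Fin N → ℝ) : ℝ :=
  (∏ i, √(2 / π) * σ i) * (∏ j, √(2 / π) / s j) / (N.factorial : ℝ)

/-- Induction on the number of denominators. The absence of an atom at 0 is carried along because
the next division needs it to have a density. -/
lemma productRatio_truncated_moment {M N : ℕ} {σ : Fin M → ℝ} {s : Fin N → ℝ}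
    (hσ : ∀ i, 0 < σ i) (hs : ∀ j, 0 < s j) {X : Fin M → Ω → ℝ} {Y : Fin N → Ω → ℝ}
    (hX : ∀ i, HasLaw (X i) (gaussianReal 0 (σ i ^ 2).toNNReal) P)
    (hY : ∀ j, HasLaw (Y j) (gaussianReal 0 (s j ^ 2).toNNReal) P)
    (hindep : iIndepFun (Sum.elim X Y) P) :
    P.map (productRatio X Y) {0} = 0 ∧
      LogGrowth N (truncatedMomentConstant σ s)
        (truncatedAbsMoment (P.map (productRatio X Y))) := by
  have hXm := fun i => (hX i).aemeasurable
  induction N with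
  | zero =>
    have hZm : AEMeasurable (productRatio X Y) P :=
      aemeasurable_productRatio hXm fun j => j.elim0
    have hZ : productRatio X Y = fun ω => ∏ i, X i ω := by
      funext ω
      simp [productRatio]
    constructor
    · rw [Measure.map_apply_of_aemeasurable hZm (measurableSet_singleton 0)]
      have : ∀ᵐ ω ∂P, ∀ i, X i ω ≠ 0 := ae_all_iff.2 fun i =>
        ae_ne_zero_of_hasLaw_gaussianReal (toNNReal_sq_ne_zero (hσ i)) (hX i)
      refine measure_mono_null (fun ω hω => ?_) this
      rw [hZ] at hω
      have h0 : ∏ i, X i ω = 0 := hω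
      obtain ⟨i, -, hi⟩ := Finset.prod_eq_zero_iff.1 h0
      exact fun hall => hall i hi
    · have hXi : iIndepFun X P := hindep.precomp (g := Sum.inl) Sum.inl_injective
      have hXa : iIndepFun (fun i ω => |X i ω|) P :=
        hXi.comp (fun _ x => |x|) fun _ => measurable_id.abs
      have hE : ∫ ω, |productRatio X Y ω| ∂P = ∏ i, √(2 / π) * σ i := by
        simp_rw [hZ, Finset.abs_prod]
        rw [hXa.integral_fun_prod_eq_prod_integral fun i => (hXm i).abs.aestronglyMeasurable]
        exact Finset.prod_congr rfl fun i _ => integral_abs_of_hasLaw_gaussianReal (hσ i) (hX i)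
      have hpos : 0 < ∏ i, √(2 / π) * σ i := Finset.prod_pos fun i _ =>
        mul_pos (sqrt_pos.2 (by positivity)) (hσ i)
      -- A non-integrable function has Bochner integral 0, so the positive value just computed
      -- forces integrability.
      have hint : Integrable (fun ω => |productRatio X Y ω|) P :=
        Integrable.of_integral_ne_zero (hE ▸ hpos.ne')
      have hint' : Integrable (fun y => |y|) (P.map (productRatio X Y)) :=
        (integrable_map_measure continuous_abs.aestronglyMeasurable hZm).2 hint
      have := Measure.isProbabilityMeasure_map (μ := P) hZm
      refine LogGrowth.of_monotone monotone_truncatedAbsMoment truncatedAbsMoment_nonneg ?_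
      have ht := tendsto_truncatedAbsMoment hint'
      rw [integral_map hZm continuous_abs.aestronglyMeasurable, hE] at ht
      simpa [truncatedMomentConstant] using ht
  | succ n ih =>
    have hYm := fun j => (hY j).aemeasurable
    obtain ⟨h0, hL⟩ := ih (fun j => hs j.castSucc) (fun j => hY j.castSucc)
      (iIndepFun.sumElim_castSucc hindep)
    have hVm : AEMeasurable (productRatio X fun j : Fin n => Y j.castSucc) P :=
      aemeasurable_productRatio hXm fun j => hYm _
    have := Measure.isProbabilityMeasure_map (μ := P) hVm
    have hv := toNNReal_sq_ne_zero (hs (Fin.last n))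
    have hlaw := hasLaw_div_gaussianReal hv hVm h0 (hY (Fin.last n))
      (indepFun_productRatio_last hXm hYm hindep)
    rw [← productRatio_succ] at hlaw
    set f := gaussianRatioDensity (P.map (productRatio X fun j : Fin n => Y j.castSucc))
      (s (Fin.last n) ^ 2).toNNReal with hf
    have hfm : Measurable f := measurable_gaussianRatioDensity
    have hfi : Integrable f := by
      have hprob := hlaw.isProbabilityMeasure_iff.1 inferInstance
      refine (lintegral_ofReal_ne_top_iff_integrable hfm.aestronglyMeasurable
        (Eventually.of_forall gaussianRatioDensity_nonneg)).1 ?_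
      rw [← setLIntegral_univ, ← withDensity_apply _ MeasurableSet.univ, hprob.measure_univ]
      exact ENNReal.one_ne_top
    rw [hlaw.map_eq]
    constructor
    · exact withDensity_absolutelyContinuous _ _ (measure_singleton 0)
    · have hstep := logGrowth_truncatedAbsMoment_withDensity gaussianRatioDensity_nonneg hfi hfm
        gaussianRatioDensity_abs (logGrowth_sq_mul_gaussianRatioDensity hv hL)
      convert! hstep using 1
      rw [← mul_assoc, two_mul_gaussianPDFReal_zero (hs _)]
      simp only [truncatedMomentConstant, Fin.prod_univ_castSucc, Nat.factorial_succ]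
      push_cast
      have := hs (Fin.last n)
      field_simp

lemma tailConstant_pos {M N : ℕ} {σ : Fin M → ℝ} {s : Fin N → ℝ} (hσ : ∀ i, 0 < σ i)
    (hs : ∀ j, 0 < s j) : 0 < tailConstant σ s := by
  have h1 : 0 < ∏ i, σ i := Finset.prod_pos fun i _ => hσ i
  have h2 : 0 < ∏ j, s j := Finset.prod_pos fun j _ => hs j
  have := pi_pos
  unfold tailConstant
  positivity

/-- The last denominator enters through φ(0), half of √(2/π)/s; this half accounts for the -2 in the
exponent of 2. -/
lemma tailConstant_succ {M n : ℕ} (σ : Fin M → ℝ) {s : Fin (n + 1) → ℝ} (hs : ∀ j, 0 < s j) :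
    gaussianPDFReal 0 (s (Fin.last n) ^ 2).toNNReal 0 *
      truncatedMomentConstant σ (fun j : Fin n => s j.castSucc) = tailConstant σ s := by
  have hφ : gaussianPDFReal 0 (s (Fin.last n) ^ 2).toNNReal 0 =
      √(2 / π) / s (Fin.last n) / 2 := by
    rw [← two_mul_gaussianPDFReal_zero (hs _)]
    ring
  have hpow : √(2 / π) ^ (M + (n + 1)) =
      2 * (2 : ℝ) ^ (((M : ℝ) + ((n + 1 : ℕ) : ℝ) - 2) / 2) /
        π ^ (((M : ℝ) + ((n + 1 : ℕ) : ℝ)) / 2) := by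
    rw [sqrt_eq_rpow, ← rpow_natCast, ← rpow_mul (by positivity), div_rpow zero_le_two pi_pos.le]
    have he : (1 / 2 : ℝ) * ((M + (n + 1) : ℕ) : ℝ) = ((M : ℝ) + ((n + 1 : ℕ) : ℝ)) / 2 := by
      push_cast; ring
    rw [he]
    congr 1
    rw [sub_div, div_self two_ne_zero, rpow_sub_one two_ne_zero]
    ring
  have hlast := hs (Fin.last n)
  have hprod : 0 < ∏ j : Fin n, s j.castSucc := Finset.prod_pos fun j _ => hs _
  have hsplit : gaussianPDFReal 0 (s (Fin.last n) ^ 2).toNNReal 0 *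
      truncatedMomentConstant σ (fun j : Fin n => s j.castSucc) =
      √(2 / π) ^ (M + (n + 1)) * (∏ i, σ i) /
        (2 * (n.factorial : ℝ) * ((∏ j : Fin n, s j.castSucc) * s (Fin.last n))) := by
    simp only [hφ, truncatedMomentConstant, Finset.prod_mul_distrib, Finset.prod_div_distrib,
      Finset.prod_const, Finset.card_univ, Fintype.card_fin]
    field_simp
    ring
  rw [hsplit, hpow]
  have hpi := rpow_pos_of_pos pi_pos (((M : ℝ) + ((n + 1 : ℕ) : ℝ)) / 2)
  simp only [tailConstant, Fin.prod_univ_castSucc, Nat.add_sub_cancel]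
  field_simp

/-- Densities of one finite law agree almost everywhere, and continuous functions that agree almost
everywhere on an open set agree on all of it. -/
lemma IsContinuousDensityOffZero.eqOn {Z : Ω → ℝ} {f g : ℝ → ℝ}
    (hf : IsContinuousDensityOffZero P Z f) (hg : IsContinuousDensityOffZero P Z g) :
    EqOn f g {0}ᶜ := by
  have hm : ∀ {h : ℝ → ℝ}, IsContinuousDensityOffZero P Z h →
      AEMeasurable (fun z => ENNReal.ofReal (h z)) := by
    intro h hh
    have := hh.continuousOn.aemeasurable (μ := volume) (measurableSet_singleton (0 : ℝ)).compl
    rw [restrict_compl_singleton] at this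
    exact this.ennreal_ofReal
  have hfin : ∫⁻ z, ENNReal.ofReal (f z) ≠ ⊤ := by
    have hprob := hf.hasLaw.isProbabilityMeasure_iff.1 inferInstance
    rw [← setLIntegral_univ, ← withDensity_apply _ MeasurableSet.univ, hprob.measure_univ]
    exact ENNReal.one_ne_top
  have hae := (withDensity_eq_iff (hm hf) (hm hg) hfin).1
    (hf.hasLaw.map_eq.symm.trans hg.hasLaw.map_eq)
  refine Measure.eqOn_open_of_ae_eq (μ := volume) (ae_restrict_of_ae ?_)
    isOpen_compl_singleton hf.continuousOn hg.continuousOn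
  filter_upwards [hae] with z hz
  exact (ENNReal.ofReal_eq_ofReal_iff (hf.nonneg z) (hg.nonneg z)).1 hz

end Probability

theorem theorem2p5 {Ω : Type*} [MeasurableSpace Ω] (P : Measure Ω) [IsProbabilityMeasure P]
    (M N : ℕ) (hN : 1 ≤ N)
    (σ : Fin M → ℝ) (s : Fin N → ℝ) (hσ : ∀ i, 0 < σ i) (hs : ∀ j, 0 < s j)
    (X : Fin M → Ω → ℝ) (Y : Fin N → Ω → ℝ)
    (hX : ∀ i, HasLaw (X i) (gaussianReal 0 (σ i ^ 2).toNNReal) P)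
    (hY : ∀ j, HasLaw (Y j) (gaussianReal 0 (s j ^ 2).toNNReal) P)
    (hindep : iIndepFun (Sum.elim X Y) P) :
    (∃ f : ℝ → ℝ, IsContinuousDensityOffZero P (productRatio X Y) f) ∧
    (∀ f : ℝ → ℝ, IsContinuousDensityOffZero P (productRatio X Y) f →
      f ~[comap (fun z : ℝ => |z|) atTop]
        fun z => tailConstant σ s * (Real.log |z| ^ (N - 1) / z ^ 2)) ∧
    (fun z : ℝ => P.real {ω | z < productRatio X Y ω}) ~[atTop]
      fun z => tailConstant σ s * (Real.log z ^ (N - 1) / z) := by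
  obtain ⟨n, rfl⟩ : ∃ n, N = n + 1 := ⟨N - 1, by omega⟩
  have hXm := fun i => (hX i).aemeasurable
  have hYm := fun j => (hY j).aemeasurable
  have hC := tailConstant_pos hσ hs
  obtain ⟨h0, hL⟩ := productRatio_truncated_moment hσ (fun j : Fin n => hs j.castSucc) hX
    (fun j : Fin n => hY j.castSucc) (iIndepFun.sumElim_castSucc hindep)
  have hVm : AEMeasurable (productRatio X fun j : Fin n => Y j.castSucc) P :=
    aemeasurable_productRatio hXm fun j => hYm _
  have := Measure.isProbabilityMeasure_map (μ := P) hVm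
  have hv := toNNReal_sq_ne_zero (hs (Fin.last n))
  have hlaw := hasLaw_div_gaussianReal hv hVm h0 (hY (Fin.last n))
    (indepFun_productRatio_last hXm hYm hindep)
  rw [← productRatio_succ] at hlaw
  have hg := logGrowth_sq_mul_gaussianRatioDensity hv hL
  rw [tailConstant_succ σ hs] at hg
  set f₀ := gaussianRatioDensity (P.map (productRatio X fun j : Fin n => Y j.castSucc))
    (s (Fin.last n) ^ 2).toNNReal with hf₀
  have hdens : IsContinuousDensityOffZero P (productRatio X Y) f₀ :=
    ⟨gaussianRatioDensity_nonneg, continuousOn_gaussianRatioDensity hv, hlaw⟩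
  rw [Nat.add_sub_cancel]
  refine ⟨⟨f₀, hdens⟩, fun f hf => ?_, ?_⟩
  · refine isEquivalent_of_tendsto_one ?_
    have ht := (hg.tendsto.comp (tendsto_comap (f := fun z : ℝ => |z|))).div_const
      (tailConstant σ s)
    rw [div_self hC.ne'] at ht
    refine ht.congr' ?_
    filter_upwards [tendsto_comap.eventually (eventually_gt_atTop 1)] with z hz
    have hz0 : z ≠ 0 := by rintro rfl; norm_num at hz
    have hlog := log_pos hz
    simp only [Function.comp_apply, Pi.div_apply]
    -- Uniqueness replaces `f` by the explicit density, whose evenness reduces the two-sided limit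
    -- to the one at +∞.
    rw [hf.eqOn hdens hz0, hf₀, gaussianRatioDensity_abs, sq_abs]
    field_simp
  · refine isEquivalent_of_tendsto_one ?_
    have ht := (tendsto_integral_Ioi_of_logGrowth hg).div_const (tailConstant σ s)
    rw [div_self hC.ne'] at ht
    refine ht.congr' ?_
    filter_upwards [eventually_gt_atTop 1] with z hz
    have hlog := log_pos hz
    have hP : P.real {ω | z < productRatio X Y ω} = ∫ x in Ioi z, f₀ x := by
      rw [hlaw.measureReal_eq (p := fun x => z < x) measurableSet_Ioi,
        integral_eq_lintegral_of_nonneg_ae (Eventually.of_forall gaussianRatioDensity_nonneg)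
          measurable_gaussianRatioDensity.aestronglyMeasurable, Measure.real]
      exact congrArg ENNReal.toReal (withDensity_apply _ measurableSet_Ioi)
    simp only [Pi.div_apply]
    rw [hP]
    field_simp
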